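/- Let $\mathbb{K}$ be a field of characteristic $0$, $n\ge 1$, and let $(L,[\cdot,\dots,\cdot],\alpha)$ be a multiplicative $n$-Hom-Leibniz algebra over $\mathbb K$: $L$ is a vector space with an $n$-linear bracket and a linear map $\alpha$ such that $\alpha[x_1,\dots,x_n]=[\alpha x_1,\dots,\alpha x_n]$ and $$[[x_1,\dots,x_n],\alpha y_1,\dots,\alpha y_{n-1}]=\sum_{i=1}^n[\alpha x_1,\dots,\alpha x_{i-1},[x_i,y_1,\dots,y_{n-1}],\alpha x_{i+1},\dots,\alpha x_n].$$ Put $\mathcal D=L^{\otimes(n-1)}$ and $\overline\alpha=\alpha^{\otimes (n-1)}$. For $z\in L$, $X=X^1\otimes\cdots\otimes X^{n-1}\in\mathcal D$ write $[z,X]=[z,X^1,\dots,X^{n-1}]$, and for $Y\in\mathcal D$ let $[X,Y]=\sum_{i}\alpha X^1\otimes\cdots\otimes[X^i,Y]\otimes\cdots\otimes\alpha X^{n-1}$ (both extended linearly in $X$). For $p\ge1$ let $C^p(L,L)$ be the space of linear maps $f:L\otimes\mathcal D^{\otimes (p-1)}\to L$ with $\alpha\circ f=f\circ(\alpha\otimes\overline\alpha^{\otimes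 (p-1)})$, and let $\delta^p:C^p(L,L)\to C^{p+1}(L,L)$ be $$\begin{aligned}\delta^pf(z,X_1,\dots,X_p)=&\sum_{1\le i<j\le p}(-1)^jf(\alpha z,\overline\alpha X_1,\dots,[X_i,X_j],\dots,\widehat{X_j},\dots,\overline\alpha X_p)+\sum_{i=1}^p(-1)^if([z,X_i],\overline\alpha X_1,\dots,\widehat{X_i},\dots,\overline\alpha X_p)\\&+\sum_{i=1}^p(-1)^{i+1}[f(z,X_1,\dots,\widehat{X_i},\dots,X_p),\overline\alpha^{\,p-1}X_i]\\&+\sum_{i=1}^{n-1}[\alpha^{p-1}z,\alpha^{p-1}X_1^1,\dots,f(X_1^i,X_2,\dots,X_p),\dots,\alpha^{p-1}X_1^{n-1}].\end{aligned}$$ Let $Z^p=\ker\delta^p$, $B^p=\operatorname{im}\delta^{p-1}$ ($B^1=0$) and $H^p(L,L)=Z^p/B^p$. For $f\in C^{p+1}(L,L)$, $g\in C^{q+1}(L,L)$ let $[f,g]_{\mathcal N}=i_f(g)+(-1)^{pq+1}i_g(f)\in C^{p+q+1}(L,L)$, where $i_f(g)=\sum_{k=0}^p(-1)^{kq}\sum_{\sigma}\epsilon(\sigma)\,f\circ_k^\sigma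 g$, the inner sum being over the permutations $\sigma$ of $\{1,\dots,p+q\}$ that fix $1,\dots,k$ and are increasing on $\{k+1,\dots,k+q\}$ and on $\{k+q+1,\dots,p+q\}$, with $$f\circ_0^\sigma g(z,X_1,\dots,X_{p+q})=f(g(z,X_{\sigma(1)},\dots,X_{\sigma(q)}),\overline\alpha^qX_{\sigma(q+1)},\dots,\overline\alpha^qX_{\sigma(p+q)})$$ and, for $1\le k\le p$, $$\begin{aligned}f\circ_k^\sigma g(z,X_1,\dots,X_{p+q})=\sum_{r=1}^{n-1}f(&\alpha^qz,\overline\alpha^qX_1,\dots,\overline\alpha^qX_{k-1},\alpha^qX_k^1\otimes\cdots\otimes g(X_k^r,X_{\sigma(k+1)},\dots,X_{\sigma(k+q)})\otimes\cdots\otimes\alpha^qX_k^{n-1},\\&\overline\alpha^qX_{\sigma(k+q+1)},\dots,\overline\alpha^qX_{\sigma(p+q)}).\end{aligned}$$ A deformation of $L$ truncated at stage $N$ is a family $F_0,\dots,F_N$ of $n$-linear maps $L^n\to L$ with $F_0=[\cdot,\dots,\cdot]$, each commuting with $\alpha$ (so $F_i\in C^2(L,L)$), such that for all $0\le r\le N$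 and all $x_1,\dots,x_n,y_1,\dots,y_{n-1}\in L$ $$\sum_{j+k=r}F_j(F_k(x_1,\dots,x_n),\alpha y_1,\dots,\alpha y_{n-1})=\sum_{i=1}^n\sum_{j+k=r}F_j(\alpha x_1,\dots,\alpha x_{i-1},F_k(x_i,y_1,\dots,y_{n-1}),\alpha x_{i+1},\dots,\alpha x_n).$$ **Proposition.** Let $s\ge2$ and let $F_0,\dots,F_{s-1}$ be a deformation of $L$ truncated at stage $s-1$. Then the obstruction cochain $$G_s=\sum_{i+j=s,\ i,j>0}[F_i,F_j]_{\mathcal N}$$ is a $3$-cocycle, i.e. $G_s\in Z^3$, and there is an $n$-linear map $F_s:L^n\to L$ such that $F_0,\dots,F_{s-1},F_s$ is a deformation of $L$ truncated at stage $s$ if and only if the class of $G_s$ in $H^3(L,L)$ is zero. -/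

import Mathlib

open scoped TensorProduct

/-- An `n`-Hom-Leibniz algebra `(L, [·,…,·], α)` with `n = m + 1` (one twisting map `α`). -/
structure NHomLeibniz (K : Type*) (L : Type*) [Field K] [AddCommGroup L] [Module K L]
    (m : ℕ) where
  /-- the `n`-ary bracket `L^{⊗ n} → L` -/
  bracket : MultilinearMap K (fun _ : Fin (m + 1) => L) L
  /-- the twisting map -/
  α : L →ₗ[K] L
  /-- `[[x₁,…,xₙ], α y₁,…,α yₙ₋₁] = ∑ᵢ [α x₁,…,[xᵢ, y₁,…,yₙ₋₁],…,α xₙ]` -/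
  fundamental : ∀ (x : Fin (m + 1) → L) (y : Fin m → L),
    bracket (Fin.cons (bracket x) (fun j => α (y j))) =
      ∑ i, bracket (Function.update (fun j => α (x j)) i (bracket (Fin.cons (x i) y)))

namespace NHomLeibniz

variable {K : Type*} {L : Type*} [Field K] [AddCommGroup L] [Module K L] {m : ℕ}

/-- `α [x₁,…,xₙ] = [α x₁,…,α xₙ]`. -/
def IsMultiplicative (A : NHomLeibniz K L m) : Prop :=
  ∀ x : Fin (m + 1) → L, A.α (A.bracket x) = A.bracket (fun i => A.α (x i))

/-- The space `D_{n-1}(L) = L^{⊗ (n-1)}`. -/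
abbrev D (_A : NHomLeibniz K L m) : Type _ := PiTensorProduct K (fun _ : Fin m => L)

/-- An `n`-linear map `F` on `L`, read as a linear map `L ⊗ D_{n-1}(L) → L`:
`A.act F X z = F(z, X¹, …, Xⁿ⁻¹)`. -/
noncomputable def act (A : NHomLeibniz K L m)
    (F : MultilinearMap K (fun _ : Fin (m + 1) => L) L) : A.D →ₗ[K] (L →ₗ[K] L) :=
  ((PiTensorProduct.lift : MultilinearMap K (fun _ : Fin m => L) L ≃ₗ[K] (A.D →ₗ[K] L)).toLinearMap
    ∘ₗ F.curryLeft).flip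

/-- `ad_X (z) = [z, X¹, …, Xⁿ⁻¹]`. -/
noncomputable def ad (A : NHomLeibniz K L m) : A.D →ₗ[K] (L →ₗ[K] L) := A.act A.bracket

/-- `ᾱ = α ⊗ ⋯ ⊗ α`. -/
noncomputable def alphaBar (A : NHomLeibniz K L m) : A.D →ₗ[K] A.D :=
  PiTensorProduct.map (fun _ => A.α)

/-- `x₁ ⊗ ⋯ ⊗ xₙ₋₁ ↦ ∑ₛ αʳ x₁ ⊗ ⋯ ⊗ u xₛ ⊗ ⋯ ⊗ αʳ xₙ₋₁`. -/
noncomputable def twist (A : NHomLeibniz K L m) (r : ℕ) (u : L →ₗ[K] L) : A.D →ₗ[K] A.D :=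
  ∑ s : Fin m, PiTensorProduct.map (Function.update (fun _ => A.α ^ r) s u)

/-- The Hom-Leibniz bracket of `D_{n-1}(L)`:
`[X, Y] = ∑ₛ α X¹ ⊗ ⋯ ⊗ [Xˢ, Y] ⊗ ⋯ ⊗ α Xⁿ⁻¹`. -/
noncomputable def bracketD (A : NHomLeibniz K L m) (X Y : A.D) : A.D := A.twist 1 (A.ad Y) X

/-- Functions of `q` arguments in `D_{n-1}(L)` and one (linear) argument in `L`. Cochains are the
multilinear and `α`-compatible ones among them, see `cochains`; `f X z` stands for
`f(z, X₁, …, X_q)`. -/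
abbrev Fun (A : NHomLeibniz K L m) (q : ℕ) : Type _ := (Fin q → A.D) → (L →ₗ[K] L)

/-- `A.cochains q` is `C^{q+1}(L, L)`: the linear maps `f : L ⊗ D_{n-1}(L)^{⊗ q} → L` such that
`α ∘ f = f ∘ (α ⊗ ᾱ^{⊗ q})`. -/
def cochains (A : NHomLeibniz K L m) (q : ℕ) : Submodule K (A.Fun q) where
  carrier := {f | (∃ φ : MultilinearMap K (fun _ : Fin q => A.D) (L →ₗ[K] L), ⇑φ = f) ∧
    ∀ (X : Fin q → A.D) (z : L), A.α (f X z) = f (fun i => A.alphaBar (X i)) (A.α z)}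
  add_mem' := by
    rintro f g ⟨⟨φ, rfl⟩, hf⟩ ⟨⟨ψ, rfl⟩, hg⟩
    exact ⟨⟨φ + ψ, rfl⟩, fun X z => by simp [hf, hg]⟩
  zero_mem' := ⟨⟨0, rfl⟩, fun X z => by simp⟩
  smul_mem' := by
    rintro c f ⟨⟨φ, rfl⟩, hf⟩
    exact ⟨⟨c • φ, rfl⟩, fun X z => by simp [hf]⟩

/-- The formula for the coboundary `δᵖ`, `p = q + 1`. Indices start at `0` here, so the signs
`(-1)^j`, `(-1)^i`, `(-1)^{i+1}` for indices starting at `1` become `(-1)^{j+1}`, `(-1)^{i+1}`,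
`(-1)^i`. -/
noncomputable def deltaFun (A : NHomLeibniz K L m) (q : ℕ) (f : A.Fun q) : A.Fun (q + 1) :=
  fun X =>
    (∑ j : Fin (q + 1), ∑ i ∈ Finset.univ.filter (· < j),
      (-1 : K) ^ ((j : ℕ) + 1) •
        (f (j.removeNth (Function.update (fun k => A.alphaBar (X k)) i
          (A.bracketD (X i) (X j)))) ∘ₗ A.α))
    + (∑ i : Fin (q + 1), (-1 : K) ^ ((i : ℕ) + 1) •
        (f (i.removeNth (fun k => A.alphaBar (X k))) ∘ₗ A.ad (X i)))
    + (∑ i : Fin (q + 1), (-1 : K) ^ (i : ℕ) •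
        (A.ad ((A.alphaBar ^ q) (X i)) ∘ₗ f (i.removeNth X)))
    + A.ad (A.twist q (f (Fin.tail X)) (X 0)) ∘ₗ (A.α ^ q)

theorem twist_add (A : NHomLeibniz K L m) (r : ℕ) (u v : L →ₗ[K] L) :
    A.twist r (u + v) = A.twist r u + A.twist r v := by
  simp only [twist, ← Finset.sum_add_distrib]
  exact Finset.sum_congr rfl fun s _ => PiTensorProduct.map_update_add _ _ _ _

theorem twist_smul (A : NHomLeibniz K L m) (r : ℕ) (c : K) (u : L →ₗ[K] L) :
    A.twist r (c • u) = c • A.twist r u := by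
  simp only [twist, Finset.smul_sum]
  exact Finset.sum_congr rfl fun s _ => PiTensorProduct.map_update_smul _ _ _ _

/-- The coboundary as a linear map. -/
noncomputable def delta (A : NHomLeibniz K L m) (q : ℕ) : A.Fun q →ₗ[K] A.Fun (q + 1) where
  toFun := A.deltaFun q
  map_add' f g := by
    funext X
    simp only [deltaFun, Pi.add_apply, LinearMap.add_comp, LinearMap.comp_add, smul_add,
      Finset.sum_add_distrib, twist_add, LinearMap.add_apply, map_add]
    abel
  map_smul' c f := by
    funext X
    simp only [deltaFun, Pi.smul_apply, LinearMap.smul_comp, LinearMap.comp_smul, smul_add,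
      Finset.smul_sum, twist_smul, LinearMap.smul_apply, map_smul, RingHom.id_apply,
      smul_comm c]

/-- `A.cocycles q` is `Z^{q+1}(L, L)`. -/
noncomputable def cocycles (A : NHomLeibniz K L m) (q : ℕ) : Submodule K (A.Fun q) :=
  A.cochains q ⊓ LinearMap.ker (A.delta q)

/-- `A.coboundaries q` is `B^{q+1}(L, L)`. -/
noncomputable def coboundaries (A : NHomLeibniz K L m) : (q : ℕ) → Submodule K (A.Fun q)
  | 0 => ⊥
  | q + 1 => (A.cochains q).map (A.delta q)

/-- `A.Cohomology q` is `H^{q+1}(L, L) = Z^{q+1}(L, L) / B^{q+1}(L, L)`. -/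
abbrev Cohomology (A : NHomLeibniz K L m) (q : ℕ) : Type _ :=
  A.cocycles q ⧸ (A.coboundaries q).submoduleOf (A.cocycles q)

/-- The cohomology class of a cocycle. -/
noncomputable def cohomologyClass (A : NHomLeibniz K L m) {q : ℕ} (f : A.cocycles q) :
    A.Cohomology q :=
  Submodule.Quotient.mk f

/-- `σ` fixes the first `k` of `N` positions and is a `(q, N - k - q)`-shuffle of the
remaining ones. -/
def IsShuffle {N : ℕ} (k q : ℕ) (σ : Equiv.Perm (Fin N)) : Prop :=
  (∀ i : Fin N, (i : ℕ) < k → σ i = i) ∧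
  (∀ i j : Fin N, k ≤ (i : ℕ) → i < j → (j : ℕ) < k + q → σ i < σ j) ∧
  (∀ i j : Fin N, k + q ≤ (i : ℕ) → i < j → σ i < σ j)

instance {N : ℕ} (k q : ℕ) (σ : Equiv.Perm (Fin N)) : Decidable (IsShuffle k q σ) := by
  unfold IsShuffle
  infer_instance

/-- `f ∘_k^σ g` for `f` with `p` and `g` with `q` arguments in `D_{n-1}(L)`, `0 ≤ k ≤ p`:
* `f(g(z, X_{σ(1)}, …, X_{σ(q)}), ᾱ^q X_{σ(q+1)}, …, ᾱ^q X_{σ(p+q)})` for `k = 0`;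
* `∑ₛ f(α^q z, ᾱ^q X₁, …, ᾱ^q X_{k-1},
    α^q X_k¹ ⊗ ⋯ ⊗ g(X_kˢ, X_{σ(k+1)}, …, X_{σ(k+q)}) ⊗ ⋯ ⊗ α^q X_k^{n-1},
    ᾱ^q X_{σ(k+q+1)}, …, ᾱ^q X_{σ(p+q)})` for `k ≥ 1`. -/
noncomputable def comp (A : NHomLeibniz K L m) {p q : ℕ} (f : A.Fun p) (g : A.Fun q)
    (k : Fin (p + 1)) (σ : Equiv.Perm (Fin (p + q))) : A.Fun (p + q) := fun X =>
  let inner : L →ₗ[K] L := g (fun i : Fin q => X (σ ⟨(k : ℕ) + i, by omega⟩))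
  let args : Fin p → A.D := fun i =>
    if (i : ℕ) + 1 < k then (A.alphaBar ^ q) (X ⟨i, by omega⟩)
    else if (i : ℕ) + 1 = k then A.twist q inner (X ⟨i, by omega⟩)
    else (A.alphaBar ^ q) (X (σ ⟨(i : ℕ) + q, by omega⟩))
  if k = 0 then f args ∘ₗ inner else f args ∘ₗ (A.α ^ q)

/-- `i_f(g) = ∑_{k=0}^p (-1)^{kq} ∑_{σ ∈ Sh(q, p-k)} ε(σ) f ∘_k^σ g`. -/
noncomputable def insertion (A : NHomLeibniz K L m) {p q : ℕ} (f : A.Fun p) (g : A.Fun q) :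
    A.Fun (p + q) :=
  ∑ k : Fin (p + 1), ∑ σ ∈ (Finset.univ : Finset (Equiv.Perm (Fin (p + q)))).filter
      (fun σ => IsShuffle k q σ),
    ((-1 : ℤ) ^ ((k : ℕ) * q) * (Equiv.Perm.sign σ : ℤ)) • A.comp f g k σ

/-- `[f, g]_N = i_f(g) + (-1)^{pq+1} i_g(f)`; the cast only identifies `q + p` with `p + q`. -/
noncomputable def bracketN (A : NHomLeibniz K L m) {p q : ℕ} (f : A.Fun p) (g : A.Fun q) :
    A.Fun (p + q) :=
  A.insertion f g +
    (-1 : ℤ) ^ (p * q + 1) • fun X => A.insertion g f (fun i => X (Fin.cast (Nat.add_comm q p) i))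

/-- An `n`-linear map `F` on `L` as a function `F(z, X)`, `X` in `D_{n-1}(L)`. -/
noncomputable def asCochain (A : NHomLeibniz K L m)
    (F : MultilinearMap K (fun _ : Fin (m + 1) => L) L) : A.Fun 1 := fun X => A.act F (X 0)

/-- `f_t = ∑_{i ≤ N} t^i F_i` is a deformation of `A` truncated at stage `N` (only `F_0, …, F_N`
matter): `F_0` is the bracket, every `F_i` commutes with `α`, and the fundamental identity for
`f_t` holds modulo `t^{N+1}`, coefficient by coefficient. -/
def IsTruncatedDeformation (A : NHomLeibniz K L m) (N : ℕ)
    (F : ℕ → MultilinearMap K (fun _ : Fin (m + 1) => L) L) : Prop :=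
  F 0 = A.bracket ∧
  (∀ i ≤ N, ∀ x : Fin (m + 1) → L, A.α (F i x) = F i (fun j => A.α (x j))) ∧
  ∀ r ≤ N, ∀ (x : Fin (m + 1) → L) (y : Fin m → L),
    ∑ jk ∈ Finset.HasAntidiagonal.antidiagonal r, F jk.1 (Fin.cons (F jk.2 x) (fun l => A.α (y l))) =
      ∑ i, ∑ jk ∈ Finset.HasAntidiagonal.antidiagonal r,
        F jk.1 (Function.update (fun l => A.α (x l)) i (F jk.2 (Fin.cons (x i) y)))

/-- The obstruction cochain `G_s = ∑_{i+j=s, i,j>0} [F_i, F_j]_N`. -/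
noncomputable def obstruction (A : NHomLeibniz K L m)
    (F : ℕ → MultilinearMap K (fun _ : Fin (m + 1) => L) L) (s : ℕ) : A.Fun 2 :=
  ∑ ij ∈ (Finset.HasAntidiagonal.antidiagonal s).filter (fun ij => 0 < ij.1 ∧ 0 < ij.2),
    A.bracketN (A.asCochain (F ij.1)) (A.asCochain (F ij.2))

end NHomLeibniz

/-!
A linear map `a : L ⊗ D_{n-1}(L) → L` is a cochain of degree one for the bracket `[·,·]_N`, and
for two of them the insertion is (`insertion_asCochain`)
`i_a(b)(X, Y) = a(ᾱY) ∘ b(X) - a(ᾱX) ∘ b(Y) - a([X, Y]_b) ∘ α`,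
where `[X, Y]_b = ∑ₛ α X¹ ⊗ ⋯ ⊗ b(Xˢ, Y) ⊗ ⋯ ⊗ α Xⁿ⁻¹`. Evaluated on pure tensors, the
fundamental identity for `f = ∑ tⁱ Fᵢ` says exactly that `i_f(f) = 0`, coefficient by coefficient
(`circCoeff_eq_zero_iff`). With `π = F₀` the bracket of the algebra, `δ φ = -(i_π(φ) + i_φ(π))` on
degree one cochains (`delta_one_apply`), so that twice the coefficient of `t^s` in `i_f(f)` is
`G_s - 2 δ F_s` (`two_smul_circCoeff_update`). As `2` is invertible, `F_s` extends the deformation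
if and only if it commutes with `α` and `G_s = δ (2 F_s)`; such an `F_s` exists if and only if
`G_s` is a coboundary.

That `G_s` is a cocycle comes from the graded Jacobi identity. The coboundary of a cochain of two
arguments makes sense with an arbitrary `a` in place of `π` (`coboundaryAlong`), and for
`α`-compatible `a` the coboundary along `a` of `i_a(a)` is zero (`coboundaryAlong_circ_self`). The
only nontrivial cancellation there is a commutator formula for the operators `[·, Y]_a` on
`D_{n-1}(L)` (`twist_one_commutator`). Polarizing this cubic identity and summing over
`i + j + k = s`, with `F_s` set to zero, gives `∑ᵢ d_{Fᵢ} (∑_{j+k=s-i} i_{F_j}(F_k)) = 0`, where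
`d_a` is the coboundary along `a`. The summands with `i > 0` vanish by the deformation equations of
lower order, and the summand with `i = 0` is half the coboundary of `G_s`.
-/

open Finset.HasAntidiagonal (antidiagonal)

/-! ### Polarization of cubic identities -/

/-- A triadditive `M` that vanishes on the diagonal of `S` has zero symmetrization on `S`. -/
theorem symmetrization_eq_zero_of_diagonal {V W : Type*} [AddCommGroup V] [AddCommGroup W]
    (M : V → V → V → W)
    (h₁ : ∀ a a' b c, M (a + a') b c = M a b c + M a' b c)
    (h₂ : ∀ a b b' c, M a (b + b') c = M a b c + M a b' c)
    (h₃ : ∀ a b c c', M a b (c + c') = M a b c + M a b c')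
    {S : AddSubmonoid V} (h : ∀ a ∈ S, M a a a = 0) {x y z : V} (hx : x ∈ S) (hy : y ∈ S)
    (hz : z ∈ S) :
    M x y z + M x z y + M y x z + M y z x + M z x y + M z y x = 0 := by
  calc
    _ = M (x + y + z) (x + y + z) (x + y + z) - M (x + y) (x + y) (x + y)
        - M (x + z) (x + z) (x + z) - M (y + z) (y + z) (y + z)
        + M x x x + M y y y + M z z z := by
      simp only [h₁, h₂, h₃]
      abel
    _ = 0 := by
      rw [h _ (add_mem (add_mem hx hy) hz), h _ (add_mem hx hy), h _ (add_mem hx hz),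
        h _ (add_mem hy hz), h x hx, h y hy, h z hz]
      simp

/-- If `M` vanishes on the diagonal, so does the coefficient of `t^s` in `M(f, f, f)` for
`f = ∑ tⁱ Fᵢ`. -/
theorem sum_antidiagonal_eq_zero_of_diagonal {V W : Type*} [AddCommGroup V] [AddCommGroup W]
    [IsAddTorsionFree W] (M : V → V → V → W)
    (h₁ : ∀ a a' b c, M (a + a') b c = M a b c + M a' b c)
    (h₂ : ∀ a b b' c, M a (b + b') c = M a b c + M a b' c)
    (h₃ : ∀ a b c c', M a b (c + c') = M a b c + M a b c')
    {S : AddSubmonoid V} (h : ∀ a ∈ S, M a a a = 0) (F : ℕ → V) (s : ℕ)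
    (hF : ∀ i ≤ s, F i ∈ S) :
    ∑ p ∈ antidiagonal s, ∑ q ∈ antidiagonal p.2,
      M (F p.1) (F q.1) (F q.2) = 0 := by
  let T (f : ℕ → ℕ → ℕ → W) : W :=
    ∑ p ∈ antidiagonal s, ∑ q ∈ antidiagonal p.2, f p.1 q.1 q.2
  -- The sum `T` is invariant under a transposition and a rotation of the indices, hence under
  -- all permutations, so that `6 T` is a sum of symmetrizations.
  have hswap : ∀ f, T f = T fun i j k => f i k j := fun f =>
    Finset.sum_congr rfl fun p _ => by
      rw [← Finset.Nat.sum_antidiagonal_swap]; rfl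
  have hrot : ∀ f, T f = T fun i j k => f j k i := fun f => by
    simp only [T]
    rw [Finset.sum_sigma', Finset.sum_sigma']
    refine Finset.sum_nbij' (fun t => ⟨(t.2.2, t.1.1 + t.2.1), (t.1.1, t.2.1)⟩)
      (fun t => ⟨(t.2.1, t.2.2 + t.1.1), (t.2.2, t.1.1)⟩) ?_ ?_ ?_ ?_ ?_
    all_goals
      rintro ⟨⟨a, b⟩, ⟨c, d⟩⟩
      simp only [Finset.mem_sigma, Finset.HasAntidiagonal.mem_antidiagonal]
    · rintro ⟨rfl, rfl⟩; exact ⟨by ring, trivial⟩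
    · rintro ⟨rfl, rfl⟩; exact ⟨by ring, trivial⟩
    · rintro ⟨-, rfl⟩; rfl
    · rintro ⟨-, rfl⟩; rfl
    · simp
  let f : ℕ → ℕ → ℕ → W := fun i j k => M (F i) (F j) (F k)
  have e₁ := hrot f
  have e₂ := hrot fun i j k => f j k i
  have e₃ := hswap f
  have e₄ := hrot fun i j k => f i k j
  have e₅ := hrot fun i j k => f j i k
  have hsum : T f + T (fun i j k => f i k j) + T (fun i j k => f j i k) + T (fun i j k => f j k i)
      + T (fun i j k => f k i j) + T (fun i j k => f k j i) = 0 := by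
    simp only [T, ← Finset.sum_add_distrib]
    refine Finset.sum_eq_zero fun p hp => Finset.sum_eq_zero fun q hq => ?_
    rw [Finset.HasAntidiagonal.mem_antidiagonal] at hp hq
    exact symmetrization_eq_zero_of_diagonal M h₁ h₂ h₃ h (hF _ (by omega)) (hF _ (by omega))
      (hF _ (by omega))
  have h6 : (6 : ℕ) • T f = 0 := by
    rw [← hsum, ← e₅, ← e₄, ← e₃, ← e₂, ← e₁]
    abel
  exact (smul_eq_zero_iff_right (by norm_num)).1 h6

namespace NHomLeibniz

variable {K : Type*} {L : Type*} [Field K] [AddCommGroup L] [Module K L] {m : ℕ}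

/-! ### Twists of tensor powers -/

theorem alphaBar_twist_one (A : NHomLeibniz K L m) {u u' : L →ₗ[K] L}
    (h : A.α ∘ₗ u = u' ∘ₗ A.α) (X : A.D) :
    A.alphaBar (A.twist 1 u X) = A.twist 1 u' (A.alphaBar X) := by
  simp only [twist, alphaBar, LinearMap.sum_apply, map_sum]
  refine Finset.sum_congr rfl fun s _ => ?_
  rw [← LinearMap.comp_apply, ← LinearMap.comp_apply, ← PiTensorProduct.map_comp,
    ← PiTensorProduct.map_comp]
  congr 2
  funext i
  by_cases hi : i = s
  · subst hi; simpa using h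
  · simp [hi]

theorem twist_one_alphaBar (A : NHomLeibniz K L m) (u : L →ₗ[K] L) (X : A.D) :
    A.twist 1 u (A.alphaBar X) = A.twist 2 (u ∘ₗ A.α) X := by
  simp only [twist, alphaBar, LinearMap.sum_apply]
  refine Finset.sum_congr rfl fun s _ => ?_
  rw [← LinearMap.comp_apply, ← PiTensorProduct.map_comp]
  congr 2
  funext i
  by_cases hi : i = s
  · subst hi; simp
  · simp [hi, pow_two, Module.End.mul_eq_comp]

theorem twist_sub (A : NHomLeibniz K L m) (r : ℕ) (u v : L →ₗ[K] L) :
    A.twist r (u - v) = A.twist r u - A.twist r v := by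
  refine eq_sub_of_add_eq ?_
  rw [← twist_add, sub_add_cancel]

/-- In a composite of two first-order twists, the terms in which the two maps act on different
tensor factors are symmetric, so only the terms on a common factor survive in the commutator. -/
theorem twist_one_commutator (A : NHomLeibniz K L m) {u u' v v' : L →ₗ[K] L}
    (hu : A.α ∘ₗ u = u' ∘ₗ A.α) (hv : A.α ∘ₗ v = v' ∘ₗ A.α) (X : A.D) :
    A.twist 1 v' (A.twist 1 u X) - A.twist 1 u' (A.twist 1 v X) =
      A.twist 2 (v' ∘ₗ u) X - A.twist 2 (u' ∘ₗ v) X := by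
  have expand : ∀ p q : L →ₗ[K] L, A.twist 1 p (A.twist 1 q X) = ∑ r : Fin m, ∑ s : Fin m,
      PiTensorProduct.map (Function.update (fun _ => A.α ^ 1) s p)
        (PiTensorProduct.map (Function.update (fun _ => A.α ^ 1) r q) X) := fun p q => by
    simp only [twist, LinearMap.sum_apply, map_sum]
  rw [expand v' u, (expand u' v).trans Finset.sum_comm]
  simp only [twist, LinearMap.sum_apply, ← Finset.sum_sub_distrib]
  refine Finset.sum_congr rfl fun r _ => ?_
  rw [Finset.sum_eq_single r]
  · simp only [← LinearMap.comp_apply, ← PiTensorProduct.map_comp]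
    congr 3 <;>
    · funext i
      by_cases hi : i = r
      · subst hi; simp
      · simp [hi, pow_two, Module.End.mul_eq_comp]
  · intro s _ hs
    rw [sub_eq_zero]
    simp only [← LinearMap.comp_apply, ← PiTensorProduct.map_comp]
    congr 2
    funext i
    by_cases hi : i = r
    · subst hi
      simpa [hs.symm] using hu
    · by_cases hi' : i = s
      · subst hi'
        simpa [hi] using hv.symm
      · simp [hi, hi']
  · simp

/-! ### Insertion and coboundary for cochains of degree one -/

/-- Degree-one cochains that need not commute with `α`: linear maps `L ⊗ D_{n-1}(L) → L`,
curried so that `a X z` stands for `a(z, X)`. -/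
abbrev Action (A : NHomLeibniz K L m) : Type _ := A.D →ₗ[K] (L →ₗ[K] L)

/-- The maps `a : L ⊗ D_{n-1}(L) → L` with `α ∘ a = a ∘ (α ⊗ ᾱ)`. -/
def equivariantActions (A : NHomLeibniz K L m) : Submodule K A.Action where
  carrier := {a | ∀ X, A.α ∘ₗ a X = a (A.alphaBar X) ∘ₗ A.α}
  add_mem' {a b} ha hb X := by
    simp only [Set.mem_ofPred_eq] at ha hb
    simp [LinearMap.comp_add, LinearMap.add_comp, ha, hb]
  zero_mem' X := by simp
  smul_mem' c a ha X := by
    simp only [Set.mem_ofPred_eq] at ha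
    simp [LinearMap.comp_smul, LinearMap.smul_comp, ha]

/-- The insertion `i_a(b)` of maps `a, b : L ⊗ D_{n-1}(L) → L`, with its three shuffles written
out. -/
noncomputable def circ (A : NHomLeibniz K L m) (a b : A.Action) (X Y : A.D) : L →ₗ[K] L :=
  a (A.alphaBar Y) ∘ₗ b X - a (A.alphaBar X) ∘ₗ b Y - a (A.twist 1 (b Y) X) ∘ₗ A.α

/-- The coboundary of a cochain `g(z, X, Y)`, with the bracket of the algebra replaced by an
arbitrary `a : L ⊗ D_{n-1}(L) → L`. -/
noncomputable def coboundaryAlong (A : NHomLeibniz K L m) (a : A.Action)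
    (g : A.D → A.D → (L →ₗ[K] L)) (X Y Z : A.D) : L →ₗ[K] L :=
  g (A.twist 1 (a Y) X) (A.alphaBar Z) ∘ₗ A.α - g (A.twist 1 (a Z) X) (A.alphaBar Y) ∘ₗ A.α
    - g (A.alphaBar X) (A.twist 1 (a Z) Y) ∘ₗ A.α
    - g (A.alphaBar Y) (A.alphaBar Z) ∘ₗ a X + g (A.alphaBar X) (A.alphaBar Z) ∘ₗ a Y
    - g (A.alphaBar X) (A.alphaBar Y) ∘ₗ a Z
    + a ((A.alphaBar ^ 2) X) ∘ₗ g Y Z - a ((A.alphaBar ^ 2) Y) ∘ₗ g X Z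
    + a ((A.alphaBar ^ 2) Z) ∘ₗ g X Y
    + a (A.twist 2 (g Y Z) X) ∘ₗ A.α ^ 2

theorem circ_add_left (A : NHomLeibniz K L m) (a a' b : A.Action) :
    A.circ (a + a') b = A.circ a b + A.circ a' b := by
  funext X Y
  simp only [circ, LinearMap.add_apply, LinearMap.add_comp, Pi.add_apply]
  abel

theorem circ_add_right (A : NHomLeibniz K L m) (a b b' : A.Action) :
    A.circ a (b + b') = A.circ a b + A.circ a b' := by
  funext X Y
  simp only [circ, LinearMap.add_apply, LinearMap.add_comp, LinearMap.comp_add, Pi.add_apply,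
    twist_add, map_add]
  abel

theorem coboundaryAlong_add_left (A : NHomLeibniz K L m) (a a' : A.Action)
    {g : A.D → A.D → (L →ₗ[K] L)} (hl : ∀ X X' Y, g (X + X') Y = g X Y + g X' Y)
    (hr : ∀ X Y Y', g X (Y + Y') = g X Y + g X Y') :
    A.coboundaryAlong (a + a') g = A.coboundaryAlong a g + A.coboundaryAlong a' g := by
  funext X Y Z
  simp only [coboundaryAlong, LinearMap.add_apply, LinearMap.add_comp, LinearMap.comp_add,
    Pi.add_apply, twist_add, hl, hr]
  abel

theorem coboundaryAlong_add_right (A : NHomLeibniz K L m) (a : A.Action)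
    (g g' : A.D → A.D → (L →ₗ[K] L)) :
    A.coboundaryAlong a (g + g') = A.coboundaryAlong a g + A.coboundaryAlong a g' := by
  funext X Y Z
  simp only [coboundaryAlong, LinearMap.add_comp, LinearMap.comp_add,
    Pi.add_apply, LinearMap.add_apply, twist_add, map_add]
  abel

theorem circ_add_fst (A : NHomLeibniz K L m) (a b : A.Action) (X X' Y : A.D) :
    A.circ a b (X + X') Y = A.circ a b X Y + A.circ a b X' Y := by
  simp only [circ, map_add, LinearMap.comp_add, LinearMap.add_comp]
  abel

theorem circ_add_snd (A : NHomLeibniz K L m) (a b : A.Action) (X Y Y' : A.D) :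
    A.circ a b X (Y + Y') = A.circ a b X Y + A.circ a b X Y' := by
  simp only [circ, map_add, LinearMap.comp_add, LinearMap.add_comp, twist_add,
    LinearMap.add_apply]
  abel

theorem circ_smul_fst (A : NHomLeibniz K L m) (a b : A.Action) (c : K) (X Y : A.D) :
    A.circ a b (c • X) Y = c • A.circ a b X Y := by
  simp only [circ, map_smul, LinearMap.comp_smul, LinearMap.smul_comp, smul_sub]

theorem circ_smul_snd (A : NHomLeibniz K L m) (a b : A.Action) (c : K) (X Y : A.D) :
    A.circ a b X (c • Y) = c • A.circ a b X Y := by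
  simp only [circ, map_smul, LinearMap.comp_smul, LinearMap.smul_comp, twist_smul,
    LinearMap.smul_apply, smul_sub]

/-- The graded Jacobi identity on the diagonal, `[a, [a, a]] = 0` for `a` of degree one. It needs no
fundamental identity for `a`, only compatibility with `α`. -/
theorem coboundaryAlong_circ_self (A : NHomLeibniz K L m) {a : A.Action}
    (ha : a ∈ A.equivariantActions) (X Y Z : A.D) :
    A.coboundaryAlong a (A.circ a a) X Y Z = 0 := by
  have hz : ∀ X z, A.α (a X z) = a (A.alphaBar X) (A.α z) := fun X z =>
    LinearMap.congr_fun (ha X) z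
  have htw : ∀ X Y, A.alphaBar (A.twist 1 (a Y) X) =
      A.twist 1 (a (A.alphaBar Y)) (A.alphaBar X) := fun X Y =>
    A.alphaBar_twist_one (ha Y) X
  have key := A.twist_one_commutator (ha Y) (ha Z) X
  ext z
  have key' := congrArg (fun W => a W (A.α (A.α z))) key
  simp only [map_sub, LinearMap.sub_apply] at key'
  simp only [coboundaryAlong, circ, LinearMap.add_apply, LinearMap.sub_apply,
    LinearMap.comp_apply, twist_sub, map_sub, pow_two, Module.End.mul_apply, htw, hz,
    twist_one_alphaBar, LinearMap.zero_apply]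
  -- All terms outside the image of `key` under `a` cancel in pairs.
  rw [← sub_eq_zero] at key'
  rw [← neg_eq_zero, ← key']
  abel

/-! ### Explicit formulas in low degrees -/

theorem insertion_asCochain (A : NHomLeibniz K L m)
    (F G : MultilinearMap K (fun _ : Fin (m + 1) => L) L) (X : Fin 2 → A.D) :
    A.insertion (A.asCochain F) (A.asCochain G) X = A.circ (A.act F) (A.act G) (X 0) (X 1) := by
  have h₀ : (Finset.univ : Finset (Equiv.Perm (Fin (1 + 1)))).filter
      (fun σ => IsShuffle 0 1 σ) = {1, Equiv.swap 0 1} := by decide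
  have h₁ : (Finset.univ : Finset (Equiv.Perm (Fin (1 + 1)))).filter
      (fun σ => IsShuffle 1 1 σ) = {1} := by decide
  have hne : (1 : Equiv.Perm (Fin (1 + 1))) ≠ Equiv.swap 0 1 := by decide
  simp [insertion, Fin.sum_univ_two, h₀, h₁, Finset.sum_pair hne, comp, asCochain, circ]
  abel

theorem delta_one_apply (A : NHomLeibniz K L m) (a : A.Action) (X : Fin 2 → A.D) :
    A.delta 1 (fun X => a (X 0)) X =
      -(A.circ A.ad a (X 0) (X 1) + A.circ a A.ad (X 0) (X 1)) := by
  have h₀ : Finset.univ.filter (· < (0 : Fin 2)) = ∅ := by decide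
  have h₁ : Finset.univ.filter (· < (1 : Fin 2)) = {0} := by decide
  simp only [delta, deltaFun, LinearMap.coe_mk, AddHom.coe_mk, Nat.reduceAdd, Fin.sum_univ_two,
    h₀, h₁, Finset.sum_empty, Finset.sum_singleton, circ, bracketD]
  simp [Fin.removeNth, Fin.tail, Fin.succAbove]
  abel

theorem delta_two_apply (A : NHomLeibniz K L m) (g : A.D → A.D → (L →ₗ[K] L))
    (X : Fin 3 → A.D) :
    A.delta 2 (fun X => g (X 0) (X 1)) X = A.coboundaryAlong A.ad g (X 0) (X 1) (X 2) := by
  have h₀ : Finset.univ.filter (· < (0 : Fin 3)) = ∅ := by decide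
  have h₁ : Finset.univ.filter (· < (1 : Fin 3)) = {0} := by decide
  have h₂ : Finset.univ.filter (· < (2 : Fin 3)) = {0, 1} := by decide
  have hne : (0 : Fin 3) ≠ 1 := by decide
  simp only [delta, deltaFun, LinearMap.coe_mk, AddHom.coe_mk, Nat.reduceAdd,
    Fin.sum_univ_three, h₀, h₁, h₂, Finset.sum_empty, Finset.sum_singleton, Finset.sum_pair hne,
    coboundaryAlong, bracketD]
  simp [Fin.removeNth, Fin.tail, Fin.succAbove, Odd.neg_one_pow (show Odd 3 by decide)]
  abel

/-! ### Multilinear maps on `L` as maps out of `L ⊗ D_{n-1}(L)` -/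

theorem act_tprod (A : NHomLeibniz K L m) (F : MultilinearMap K (fun _ : Fin (m + 1) => L) L)
    (x : Fin m → L) (z : L) :
    A.act F (PiTensorProduct.tprod K x) z = F (Fin.cons z x) := by
  simp [act]

theorem alphaBar_tprod (A : NHomLeibniz K L m) (x : Fin m → L) :
    A.alphaBar (PiTensorProduct.tprod K x) = PiTensorProduct.tprod K fun i => A.α (x i) := by
  simp [alphaBar]

theorem twist_one_tprod (A : NHomLeibniz K L m) (u : L →ₗ[K] L) (x : Fin m → L) :
    A.twist 1 u (PiTensorProduct.tprod K x) =
      ∑ i, PiTensorProduct.tprod K (Function.update (fun l => A.α (x l)) i (u (x i))) := by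
  simp only [twist, LinearMap.sum_apply, PiTensorProduct.map_tprod]
  refine Finset.sum_congr rfl fun i _ => congrArg _ ?_
  funext j
  by_cases h : j = i
  · subst h; simp
  · simp [h]

/-- Maps out of `L ⊗ D_{n-1}(L)` all come from `n`-linear maps. -/
theorem exists_act_eq (A : NHomLeibniz K L m) (a : A.Action) : ∃ F, A.act F = a := by
  refine ⟨LinearMap.uncurryLeft
    ((PiTensorProduct.lift :
      MultilinearMap K (fun _ : Fin m => L) L ≃ₗ[K] (A.D →ₗ[K] L)).symm.toLinearMap
        ∘ₗ a.flip), ?_⟩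
  refine PiTensorProduct.ext (MultilinearMap.ext fun x => LinearMap.ext fun z => ?_)
  simp [act_tprod]

theorem act_mem_equivariantActions_iff (A : NHomLeibniz K L m)
    (F : MultilinearMap K (fun _ : Fin (m + 1) => L) L) :
    A.act F ∈ A.equivariantActions ↔
      ∀ x : Fin (m + 1) → L, A.α (F x) = F (fun i => A.α (x i)) := by
  constructor
  · intro h x
    have := LinearMap.congr_fun (h (PiTensorProduct.tprod K (Fin.tail x))) (x 0)
    rw [alphaBar_tprod, LinearMap.comp_apply, LinearMap.comp_apply, act_tprod, act_tprod,
      Fin.cons_self_tail] at this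
    rw [this]
    congr 1
    funext i
    refine Fin.cases ?_ (fun j => ?_) i <;> simp [Fin.tail]
  · intro h X
    have : (A.act F).compr₂ A.α = ((A.act F).compl₁₂ A.alphaBar A.α) := by
      refine PiTensorProduct.ext (MultilinearMap.ext fun x => LinearMap.ext fun z => ?_)
      simp only [LinearMap.compMultilinearMap_apply, LinearMap.compr₂_apply,
        LinearMap.compl₁₂_apply, act_tprod, alphaBar_tprod, h]
      congr 1
      funext i
      refine Fin.cases ?_ (fun j => ?_) i <;> simp
    exact LinearMap.ext fun z => LinearMap.congr_fun (LinearMap.congr_fun this X) z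

/-! ### The deformation equations -/

/-- The coefficient of `t^r` in `i_f(f)` for `f = ∑ tⁱ Fᵢ`. -/
noncomputable def circCoeff (A : NHomLeibniz K L m)
    (F : ℕ → MultilinearMap K (fun _ : Fin (m + 1) => L) L) (r : ℕ) :
    A.D → A.D → (L →ₗ[K] L) :=
  ∑ jk ∈ antidiagonal r, A.circ (A.act (F jk.1)) (A.act (F jk.2))

theorem circ_tprod_apply (A : NHomLeibniz K L m)
    (F G : MultilinearMap K (fun _ : Fin (m + 1) => L) L) (x : Fin (m + 1) → L) (y : Fin m → L) :
    A.circ (A.act F) (A.act G) (PiTensorProduct.tprod K (Fin.tail x))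
        (PiTensorProduct.tprod K y) (x 0) =
      F (Fin.cons (G x) fun l => A.α (y l)) -
        ∑ i, F (Function.update (fun l => A.α (x l)) i (G (Fin.cons (x i) y))) := by
  have hx : (fun l => A.α (x l)) = Fin.cons (A.α (x 0)) fun l => A.α (Fin.tail x l) := by
    funext i
    refine Fin.cases ?_ (fun j => ?_) i <;> simp [Fin.tail]
  simp only [circ, LinearMap.sub_apply, LinearMap.comp_apply, alphaBar_tprod, twist_one_tprod,
    map_sum, LinearMap.sum_apply, act_tprod, Fin.cons_self_tail, Fin.sum_univ_succ, hx,
    Fin.update_cons_zero, ← Fin.cons_update]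
  rw [sub_sub]
  rfl

/-- The coefficient of `t^r` in the fundamental identity for `f` is the coefficient of `t^r` in
`i_f(f) = 0`, evaluated on pure tensors. -/
theorem circCoeff_eq_zero_iff (A : NHomLeibniz K L m)
    (F : ℕ → MultilinearMap K (fun _ : Fin (m + 1) => L) L) (r : ℕ) :
    A.circCoeff F r = 0 ↔ ∀ (x : Fin (m + 1) → L) (y : Fin m → L),
      ∑ jk ∈ antidiagonal r, F jk.1 (Fin.cons (F jk.2 x) (fun l => A.α (y l))) =
        ∑ i, ∑ jk ∈ antidiagonal r,
          F jk.1 (Function.update (fun l => A.α (x l)) i (F jk.2 (Fin.cons (x i) y))) := by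
  have happly : ∀ (x : Fin (m + 1) → L) (y : Fin m → L),
      A.circCoeff F r (PiTensorProduct.tprod K (Fin.tail x)) (PiTensorProduct.tprod K y) (x 0) =
      ∑ jk ∈ antidiagonal r, F jk.1 (Fin.cons (F jk.2 x) (fun l => A.α (y l))) -
        ∑ i, ∑ jk ∈ antidiagonal r,
          F jk.1 (Function.update (fun l => A.α (x l)) i (F jk.2 (Fin.cons (x i) y))) := by
    intro x y
    rw [Finset.sum_comm, ← Finset.sum_sub_distrib]
    simp only [circCoeff, Finset.sum_apply, LinearMap.sum_apply, circ_tprod_apply]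
  constructor
  · intro h x y
    rw [← sub_eq_zero, ← happly, h]
    rfl
  · intro h
    -- The coefficient is bilinear in `X` and `Y`, so it is determined by its values on pure tensors.
    let B : A.D →ₗ[K] A.D →ₗ[K] (L →ₗ[K] L) := ∑ jk ∈ antidiagonal r,
      LinearMap.mk₂ K (A.circ (A.act (F jk.1)) (A.act (F jk.2))) (A.circ_add_fst _ _)
        (A.circ_smul_fst _ _) (A.circ_add_snd _ _) (A.circ_smul_snd _ _)
    have hB : ∀ X Y, B X Y = A.circCoeff F r X Y := fun X Y => by
      simp [B, circCoeff, LinearMap.sum_apply]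
    have hB₀ : B = 0 := by
      refine PiTensorProduct.ext (MultilinearMap.ext fun x => PiTensorProduct.ext
        (MultilinearMap.ext fun y => LinearMap.ext fun z => ?_))
      have := happly (Fin.cons z x) y
      rw [h, sub_self, Fin.tail_cons, Fin.cons_zero] at this
      simp only [LinearMap.compMultilinearMap_apply, hB, this]
      rfl
    funext X Y
    rw [← hB, hB₀]
    rfl

theorem isTruncatedDeformation_iff (A : NHomLeibniz K L m) (N : ℕ)
    (F : ℕ → MultilinearMap K (fun _ : Fin (m + 1) => L) L) :
    A.IsTruncatedDeformation N F ↔ F 0 = A.bracket ∧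
      (∀ i ≤ N, A.act (F i) ∈ A.equivariantActions) ∧ ∀ r ≤ N, A.circCoeff F r = 0 := by
  simp only [IsTruncatedDeformation, act_mem_equivariantActions_iff, circCoeff_eq_zero_iff]

/-! ### The obstruction -/

theorem obstruction_apply (A : NHomLeibniz K L m)
    (F : ℕ → MultilinearMap K (fun _ : Fin (m + 1) => L) L) (s : ℕ) (X : Fin 2 → A.D) :
    A.obstruction F s X = (2 : K) •
      ∑ jk ∈ (antidiagonal s).filter (fun jk => 0 < jk.1 ∧ 0 < jk.2),
        A.circ (A.act (F jk.1)) (A.act (F jk.2)) (X 0) (X 1) := by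
  have h : ∀ jk : ℕ × ℕ, A.bracketN (A.asCochain (F jk.1)) (A.asCochain (F jk.2)) X =
      A.circ (A.act (F jk.1)) (A.act (F jk.2)) (X 0) (X 1)
        + A.circ (A.act (F jk.2)) (A.act (F jk.1)) (X 0) (X 1) := fun jk => by
    simp [bracketN, insertion_asCochain]
  rw [obstruction, Finset.sum_apply, Finset.sum_congr rfl fun jk _ => h jk,
    Finset.sum_add_distrib, two_smul]
  congr 1
  refine Finset.sum_nbij' Prod.swap Prod.swap ?_ ?_ ?_ ?_ ?_ <;> simp <;> omega

theorem circCoeff_update_of_lt (A : NHomLeibniz K L m)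
    (F : ℕ → MultilinearMap K (fun _ : Fin (m + 1) => L) L)
    (Φ : MultilinearMap K (fun _ : Fin (m + 1) => L) L) {r s : ℕ} (hr : r < s) :
    A.circCoeff (Function.update F s Φ) r = A.circCoeff F r := by
  refine Finset.sum_congr rfl fun jk hjk => ?_
  rw [Finset.HasAntidiagonal.mem_antidiagonal] at hjk
  rw [Function.update_of_ne (by omega), Function.update_of_ne (by omega)]

/-- The coefficient of `t^s` in `2 i_f(f)` is the obstruction corrected by the coboundary of the
new term `Φ`: the terms with `Φ` are `i_π(Φ) + i_Φ(π) = -δΦ`, with `π` the bracket. -/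
theorem two_smul_circCoeff_update (A : NHomLeibniz K L m)
    {F : ℕ → MultilinearMap K (fun _ : Fin (m + 1) => L) L} (h0 : F 0 = A.bracket) {s : ℕ}
    (hs : 0 < s) (Φ : MultilinearMap K (fun _ : Fin (m + 1) => L) L) (X : Fin 2 → A.D) :
    (2 : K) • A.circCoeff (Function.update F s Φ) s (X 0) (X 1) =
      A.obstruction F s X - (2 : K) • A.delta 1 (fun X => A.act Φ (X 0)) X := by
  -- Only the terms with indices `(0, s)` and `(s, 0)` involve `Φ`, because `s > 0`.
  have hne : ((0, s) : ℕ × ℕ) ≠ (s, 0) := by simp; omega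
  have hends : (antidiagonal s).filter (fun jk => ¬(0 < jk.1 ∧ 0 < jk.2)) = {(0, s), (s, 0)} := by
    ext ⟨j, k⟩
    simp
    omega
  rw [obstruction_apply, ← smul_sub, delta_one_apply, circCoeff,
    ← Finset.sum_filter_add_sum_filter_not _ (fun jk : ℕ × ℕ => 0 < jk.1 ∧ 0 < jk.2), hends,
    Finset.sum_pair hne, sub_neg_eq_add]
  have hlow : ∑ jk ∈ (antidiagonal s).filter (fun jk => 0 < jk.1 ∧ 0 < jk.2),
      A.circ (A.act (Function.update F s Φ jk.1)) (A.act (Function.update F s Φ jk.2)) =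
      ∑ jk ∈ (antidiagonal s).filter (fun jk => 0 < jk.1 ∧ 0 < jk.2),
        A.circ (A.act (F jk.1)) (A.act (F jk.2)) := by
    refine Finset.sum_congr rfl fun jk hjk => ?_
    rw [Finset.mem_filter, Finset.HasAntidiagonal.mem_antidiagonal] at hjk
    rw [Function.update_of_ne (by omega), Function.update_of_ne (by omega)]
  simp only [hlow, Function.update_self, Function.update_of_ne hs.ne, h0, Pi.add_apply,
    Finset.sum_apply]
  rfl

theorem circ_mem_cochains (A : NHomLeibniz K L m) {a b : A.Action}
    (ha : a ∈ A.equivariantActions) (hb : b ∈ A.equivariantActions) :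
    (fun X : Fin 2 → A.D => A.circ a b (X 0) (X 1)) ∈ A.cochains 2 := by
  refine ⟨⟨⟨fun X => A.circ a b (X 0) (X 1), ?_, ?_⟩, rfl⟩, fun X z => ?_⟩
  · intro hd X i x y
    obtain rfl : hd = instDecidableEqFin 2 := Subsingleton.elim _ _
    fin_cases i
    · simpa using A.circ_add_fst a b x y (X 1)
    · simpa using A.circ_add_snd a b (X 0) x y
  · intro hd X i c x
    obtain rfl : hd = instDecidableEqFin 2 := Subsingleton.elim _ _
    fin_cases i
    · simpa using A.circ_smul_fst a b c x (X 1)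
    · simpa using A.circ_smul_snd a b c (X 0) x
  · have haz : ∀ X z, A.α (a X z) = a (A.alphaBar X) (A.α z) := fun X z =>
      LinearMap.congr_fun (ha X) z
    have hbz : ∀ X z, A.α (b X z) = b (A.alphaBar X) (A.α z) := fun X z =>
      LinearMap.congr_fun (hb X) z
    simp only [circ, LinearMap.sub_apply, LinearMap.comp_apply, map_sub, haz, hbz,
      A.alphaBar_twist_one (hb (X 1))]

theorem mem_cochains_one_iff (A : NHomLeibniz K L m) (f : A.Fun 1) :
    f ∈ A.cochains 1 ↔ ∃ Φ : MultilinearMap K (fun _ : Fin (m + 1) => L) L,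
      A.act Φ ∈ A.equivariantActions ∧ (fun X => A.act Φ (X 0)) = f := by
  constructor
  · rintro ⟨⟨φ, rfl⟩, hf⟩
    obtain ⟨Φ, hΦ⟩ := A.exists_act_eq ((MultilinearMap.ofSubsingleton K A.D _ (0 : Fin 1)).symm φ)
    have hΦφ : ∀ X, A.act Φ X = φ fun _ => X := fun X => by rw [hΦ]; rfl
    refine ⟨Φ, fun X => LinearMap.ext fun z => ?_, funext fun X => ?_⟩
    · rw [hΦφ, hΦφ]
      exact hf (fun _ => X) z
    · rw [hΦφ]
      exact congrArg φ (funext fun i => congrArg X (Subsingleton.elim _ _))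
  · rintro ⟨Φ, hΦ, rfl⟩
    exact ⟨⟨MultilinearMap.ofSubsingleton K A.D _ (0 : Fin 1) (A.act Φ), rfl⟩,
      fun X z => LinearMap.congr_fun (hΦ (X 0)) z⟩

/-- The `t^s` coefficient of the graded Jacobi identity `[f, [f, f]] = 0` for `f = ∑ tⁱ Fᵢ`. -/
theorem coboundaryAlong_circCoeff_eq_zero [CharZero K] (A : NHomLeibniz K L m) {s : ℕ}
    {F : ℕ → MultilinearMap K (fun _ : Fin (m + 1) => L) L}
    (h0 : F 0 = A.bracket) (hF : ∀ i ≤ s, A.act (F i) ∈ A.equivariantActions)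
    (hlow : ∀ r < s, A.circCoeff F r = 0) (X Y Z : A.D) :
    A.coboundaryAlong A.ad (A.circCoeff F s) X Y Z = 0 := by
  have : IsAddTorsionFree (L →ₗ[K] L) := .of_isTorsionFree K _
  have key := sum_antidiagonal_eq_zero_of_diagonal
    (fun a b c : A.Action => A.coboundaryAlong a (A.circ b c) X Y Z)
    (fun a a' b c => congrFun₃ (A.coboundaryAlong_add_left a a' (A.circ_add_fst b c)
      (A.circ_add_snd b c)) X Y Z)
    (fun a b b' c => by rw [circ_add_left, coboundaryAlong_add_right]; rfl)
    (fun a b c c' => by rw [circ_add_right, coboundaryAlong_add_right]; rfl)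
    (S := A.equivariantActions.toAddSubmonoid)
    (fun a ha => A.coboundaryAlong_circ_self ha X Y Z) (fun i => A.act (F i)) s hF
  have hsum : ∀ (a : A.Action) r,
      ∑ q ∈ antidiagonal r, A.coboundaryAlong a (A.circ (A.act (F q.1)) (A.act (F q.2))) X Y Z
        = A.coboundaryAlong a (A.circCoeff F r) X Y Z := fun a r => by
    have := map_sum (AddMonoidHom.mk' (A.coboundaryAlong a) (A.coboundaryAlong_add_right a))
      (fun q : ℕ × ℕ => A.circ (A.act (F q.1)) (A.act (F q.2))) (antidiagonal r)
    have h := congrFun₃ this X Y Z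
    simp only [Finset.sum_apply, AddMonoidHom.mk'_apply] at h
    exact h.symm
  -- The terms with `i > 0` contain a coefficient of `i_f(f)` of order below `s`.
  simp only [hsum] at key
  rw [Finset.sum_eq_single (0, s)] at key
  · simpa [h0, ad] using key
  · rintro ⟨i, r⟩ hir hne
    rw [Finset.HasAntidiagonal.mem_antidiagonal] at hir
    have hr : r < s := by
      rcases Nat.eq_zero_or_pos i with rfl | hi
      · exact absurd (by simp at hir; simp [hir]) hne
      · simp at hir; omega
    simp only [hlow r hr]
    exact congrFun₃ (map_zero (AddMonoidHom.mk' _ (A.coboundaryAlong_add_right _))) X Y Z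
  · intro h
    simp at h

theorem obstruction_mem_cocycles [CharZero K] (A : NHomLeibniz K L m) {s : ℕ} (hs : 0 < s)
    {F : ℕ → MultilinearMap K (fun _ : Fin (m + 1) => L) L}
    (hF : A.IsTruncatedDeformation (s - 1) F) : A.obstruction F s ∈ A.cocycles 2 := by
  rw [isTruncatedDeformation_iff] at hF
  obtain ⟨h0, heq, hlow⟩ := hF
  refine ⟨?_, ?_⟩
  · rw [show A.obstruction F s = (2 : K) •
      ∑ jk ∈ (antidiagonal s).filter (fun jk => 0 < jk.1 ∧ 0 < jk.2),
        fun X : Fin 2 → A.D => A.circ (A.act (F jk.1)) (A.act (F jk.2)) (X 0) (X 1) from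
      funext fun X => by rw [obstruction_apply, Pi.smul_apply, Finset.sum_apply]]
    refine Submodule.smul_mem _ _ (Submodule.sum_mem _ fun jk hjk => ?_)
    rw [Finset.mem_filter, Finset.HasAntidiagonal.mem_antidiagonal] at hjk
    exact A.circ_mem_cochains (heq _ (by omega)) (heq _ (by omega))
  · -- With the missing term set to `0`, the obstruction is twice the coefficient of `t^s`.
    have hact0 : A.act (0 : MultilinearMap K (fun _ : Fin (m + 1) => L) L) = 0 := by
      refine PiTensorProduct.ext (MultilinearMap.ext fun x => LinearMap.ext fun z => ?_)
      simp [act_tprod]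
    have hobs : A.obstruction F s =
        (2 : K) • fun X => A.circCoeff (Function.update F s 0) s (X 0) (X 1) := by
      funext X
      have := A.two_smul_circCoeff_update h0 hs 0 X
      simp only [hact0, LinearMap.zero_apply] at this
      rw [Pi.smul_apply, this, show (fun _ : Fin 1 → A.D => (0 : L →ₗ[K] L)) = 0 from rfl,
        map_zero]
      simp
    change A.delta 2 (A.obstruction F s) = 0
    rw [hobs, map_smul]
    refine smul_eq_zero_of_right _ (funext fun X => ?_)
    rw [delta_two_apply]
    refine A.coboundaryAlong_circCoeff_eq_zero (by rw [Function.update_of_ne hs.ne, h0])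
      (fun i hi => ?_) (fun r hr => ?_) _ _ _
    · rcases hi.eq_or_lt with rfl | hi
      · rw [Function.update_self, hact0]
        exact zero_mem _
      · rw [Function.update_of_ne hi.ne]
        exact heq i (by omega)
    · rw [← hlow r (by omega)]
      exact A.circCoeff_update_of_lt F 0 hr

theorem isTruncatedDeformation_update_iff [CharZero K] (A : NHomLeibniz K L m) {s : ℕ}
    (hs : 0 < s) {F : ℕ → MultilinearMap K (fun _ : Fin (m + 1) => L) L}
    (hF : A.IsTruncatedDeformation (s - 1) F)
    (Φ : MultilinearMap K (fun _ : Fin (m + 1) => L) L) :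
    A.IsTruncatedDeformation s (Function.update F s Φ) ↔ A.act Φ ∈ A.equivariantActions ∧
      (2 : K) • A.delta 1 (fun X => A.act Φ (X 0)) = A.obstruction F s := by
  rw [isTruncatedDeformation_iff] at hF ⊢
  obtain ⟨h0, heq, hlow⟩ := hF
  have hs' : A.circCoeff (Function.update F s Φ) s = 0 ↔
      (2 : K) • A.delta 1 (fun X => A.act Φ (X 0)) = A.obstruction F s := by
    have h2 := A.two_smul_circCoeff_update h0 hs Φ
    constructor
    · intro h
      funext X
      have := h2 X
      rw [h] at this
      exact (sub_eq_zero.1 (this.symm.trans (smul_zero _))).symm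
    · intro h
      funext X Y
      have := h2 ![X, Y]
      rw [← h, Pi.smul_apply, sub_self] at this
      exact (smul_eq_zero.1 this).resolve_left two_ne_zero
  rw [← hs']
  constructor
  · rintro ⟨-, h, h'⟩
    exact ⟨by simpa using h s le_rfl, h' s le_rfl⟩
  · rintro ⟨h, h'⟩
    refine ⟨by rw [Function.update_of_ne hs.ne, h0], fun i hi => ?_, fun r hr => ?_⟩
    · rcases hi.eq_or_lt with rfl | hi
      · rwa [Function.update_self]
      · rw [Function.update_of_ne hi.ne]
        exact heq i (by omega)
    · rcases hr.eq_or_lt with rfl | hr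
      · exact h'
      · rw [A.circCoeff_update_of_lt F Φ hr]
        exact hlow r (by omega)

end NHomLeibniz

theorem mainTheorem9 {K : Type*} {L : Type*} [Field K] [CharZero K] [AddCommGroup L] [Module K L]
    {m : ℕ} (A : NHomLeibniz K L m) (hA : A.IsMultiplicative) (s : ℕ) (hs : 2 ≤ s)
    (F : ℕ → MultilinearMap K (fun _ : Fin (m + 1) => L) L)
    (hF : A.IsTruncatedDeformation (s - 1) F) :
    ∃ hG : A.obstruction F s ∈ A.cocycles 2,
      ((∃ Φ : MultilinearMap K (fun _ : Fin (m + 1) => L) L,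
          A.IsTruncatedDeformation s (Function.update F s Φ)) ↔
        A.cohomologyClass ⟨A.obstruction F s, hG⟩ = 0) := by
  have hs₀ : 0 < s := by omega
  refine ⟨A.obstruction_mem_cocycles hs₀ hF, ?_⟩
  simp only [A.isTruncatedDeformation_update_iff hs₀ hF]
  rw [NHomLeibniz.cohomologyClass, Submodule.Quotient.mk_eq_zero]
  change _ ↔ A.obstruction F s ∈ A.coboundaries 2
  constructor
  · rintro ⟨Φ, hΦ, h⟩
    exact ⟨(2 : K) • fun X => A.act Φ (X 0),
      Submodule.smul_mem _ _ ((A.mem_cochains_one_iff _).2 ⟨Φ, hΦ, rfl⟩), by rw [map_smul, h]⟩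
  · rintro ⟨f, hf, h⟩
    obtain ⟨Φ, hΦ, hf'⟩ := (A.mem_cochains_one_iff _).1
      (Submodule.smul_mem _ (2⁻¹ : K) hf)
    refine ⟨Φ, hΦ, ?_⟩
    rw [hf', map_smul, smul_inv_smul₀ two_ne_zero]
    exact h
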